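/- **Theorem 3.** Let $t\ge 1$, let $\mathcal W_1,\dots,\mathcal W_t,\mathcal Y_1,\dots,\mathcal Y_t$ be finite alphabets, and let $(W_1,\dots,W_t,Y_1,\dots,Y_t)$ have joint pmf $q$ on $\mathcal W_1\times\cdots\times\mathcal W_t\times\mathcal Y_1\times\cdots\times\mathcal Y_t$. Put $X=(W_1,\dots,W_t)$ and $\mathcal X=\mathcal W_1\times\cdots\times\mathcal W_t$. For $n\ge1$, let $(X_i,Y_{1,i},\dots,Y_{t,i})_{i=1}^n$, with $X_i=(W_{1,i},\dots,W_{t,i})$, be iid according to $q$. A code of blocklength $n$ consists of finite sets $\mathcal M_1,\dots,\mathcal M_t$, an encoder $f:\mathcal X^n\to\mathcal M_1\times\cdots\times\mathcal M_t$, and decoders $g_l:\mathcal M_1\times\cdots\times\mathcal M_l\times\mathcal Y_l^n\to\mathcal W_l^n$ for $l=1,\dots,t$. With $(M_1,\dots,M_t)=f(X_1,\dots,X_n)$ and $\hat{\mathbf W}_l=g_l(M_1,\dots,M_l,Y_{l,1},\dots,Y_{l,n})$, its rates are $\kappa_l=\frac1n\log_2|\mathcal M_l|$ and its average symbol error probabilities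 are $P_e^l=\frac1n\sum_{i=1}^n\Pr[\hat W_{l,i}\ne W_{l,i}]$. Let $\mathcal R(0,\dots,0)$ be the set of all $\mathbf r\in\mathbb R_+^t$ such that for every $\epsilon>0$ there are an $n\ge1$ and a code of blocklength $n$ with $P_e^l\le\epsilon$ and $\kappa_l\le r_l+\epsilon$ for all $l=1,\dots,t$. If the side-information is degraded, i.e. $(W_1,\dots,W_t) - Y_t - Y_{t-1}-\cdots-Y_1$ is a Markov chain under $q$, then $$\mathcal R(0,\dots,0)=\Big\{\mathbf r\in\mathbb R_+^t:\ \sum_{k=1}^l r_k\ \ge\ \sum_{k=1}^l H(W_k\mid W_1,\dots,W_{k-1},Y_k)\ \text{ for all } l=1,\dots,t\Big\},$$ where $H$ is conditional entropy in bits. -/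

import Mathlib

open scoped NNReal

noncomputable section

namespace SuccRef

/-- The probability `Pr[A = a]` when the outcome is drawn according to the pmf `p`. -/
def prob {Ω α : Type*} (p : PMF Ω) (A : Ω → α) (a : α) : ℝ :=
  (p.map A a).toReal

/-- The conditional entropy `H(A | B)`, in bits. The convention `0 log 0 = 0` holds
because the logarithm takes a finite value at `0`. -/
def condEntropy {Ω α β : Type*} [Fintype α] [Fintype β] (p : PMF Ω) (A : Ω → α) (B : Ω → β) : ℝ :=
  -∑ a, ∑ b, prob p (fun ω => (A ω, B ω)) (a, b) *
    Real.logb 2 (prob p (fun ω => (A ω, B ω)) (a, b) / prob p B b)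

open Classical in
/-- The Markov chain `A - B - C` under `p`. -/
def IsMarkov {Ω α β γ : Type*} (p : PMF Ω) (A : Ω → α) (B : Ω → β) (C : Ω → γ) : Prop :=
  ∀ a b c, prob p (fun ω => (A ω, B ω, C ω)) (a, b, c) =
    if 0 < prob p B b then
      prob p (fun ω => (A ω, B ω)) (a, b) * prob p (fun ω => (B ω, C ω)) (b, c) / prob p B b
    else 0

/-- Degraded side-information: `X - Y_t - Y_{t-1} - ⋯ - Y_1` is a Markov chain under `q`, i.e.
for every `l` the variables before `Y_l` in the chain, the variable `Y_l`, and the variables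
after `Y_l` form a Markov chain of length three. -/
def IsDegraded {t : ℕ} {X : Type*} {Y : Fin t → Type*} (q : PMF (X × ∀ l, Y l)) : Prop :=
  ∀ l : Fin t, IsMarkov q
    (fun z => (z.1, fun j : {j : Fin t // l < j} => z.2 j))
    (fun z => z.2 l)
    (fun z => fun j : {j : Fin t // j < l} => z.2 j)

/-- A successive-refinement code of blocklength `n`: message sets `M_l = {0, …, size l - 1}`, an
encoder `f : X^n → M_1 × ⋯ × M_t`, and decoders `g_l : M_1 × ⋯ × M_l × Y_l^n → Xhat_l^n`. -/
structure Code {t : ℕ} (X : Type*) (Y Xhat : Fin t → Type*) (n : ℕ) where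
  size : Fin t → ℕ
  enc : (Fin n → X) → ∀ l, Fin (size l)
  dec : ∀ l : Fin t, (∀ k : {k : Fin t // k ≤ l}, Fin (size k)) → (Fin n → Y l) → Fin n → Xhat l

namespace Code

variable {t : ℕ} {X : Type*} {Y Xhat : Fin t → Type*} {n : ℕ}

/-- The rate on channel `l`, in bits per source symbol. -/
def rate (c : Code X Y Xhat n) (l : Fin t) : ℝ :=
  1 / (n : ℝ) * Real.logb 2 (c.size l)

/-- The replica produced by decoder `l` when the source and side-information sequences are `z`. -/
def replica (c : Code X Y Xhat n) (l : Fin t) (z : Fin n → X × ∀ l, Y l) : Fin n → Xhat l :=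
  c.dec l (fun k => c.enc (fun i => (z i).1) k) (fun i => (z i).2 l)

/-- The average distortion at decoder `l` when the `n` letters are drawn iid according to `q`. -/
def distortion [Fintype X] [∀ l, Fintype (Y l)] (c : Code X Y Xhat n) (q : PMF (X × ∀ l, Y l))
    (δ : ∀ l, X → Xhat l → ℝ≥0) (l : Fin t) : ℝ :=
  ∑ z : Fin n → X × ∀ l, Y l,
    (∏ i, (q (z i)).toReal) * (1 / (n : ℝ) * ∑ i, (δ l (z i).1 (c.replica l z i) : ℝ))

end Code

/-- The region `R(d)` of all `d`-admissible rate tuples. -/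
def rateRegion {t : ℕ} {X : Type*} {Y Xhat : Fin t → Type*} [Fintype X] [∀ l, Fintype (Y l)]
    (q : PMF (X × ∀ l, Y l)) (δ : ∀ l, X → Xhat l → ℝ≥0) (d : Fin t → ℝ≥0) :
    Set (Fin t → ℝ≥0) :=
  {r | ∀ ε : ℝ, 0 < ε → ∃ n : ℕ, 0 < n ∧ ∃ c : Code X Y Xhat n,
    (∀ l, c.distortion q δ l ≤ d l + ε) ∧ (∀ l, c.rate l ≤ r l + ε)}

open Classical in
/-- The distortion measure for recovering the private message `W_l` at decoder `l`:
`0` if `w_l` is reproduced correctly and `1` otherwise. -/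
def privateDistortion {t : ℕ} (W : Fin t → Type*) (l : Fin t) (w : ∀ k, W k) (what : W l) : ℝ≥0 :=
  if w l = what then 0 else 1

end SuccRef

end

/-!
Converse. Copy each replica through a channel that errs with a small probability `δ`; for fixed
messages this gives a kernel `Q_k` predicting the sequence of `W_k` from that of `Y_k`. By
degradedness the conditional probability of `W_k` given `W_1, …, W_{k-1}, Y_k` does not change when
`Y_1, …, Y_{k-1}` are added to the condition, so the product over `k ≤ l` of the likelihood ratios
of `Q_k` against these conditional probabilities has mean at most `1`, one factor being averaged out
after the other. Summing over the messages bounds the mean by `|M_1| ⋯ |M_l|`, and Jensen's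
inequality turns this into a bound on the sum of the entropies up to a term that vanishes with `δ`.

Achievability. For `l ≥ k`, given `W_1, …, W_{k-1}`, the uncertainty about `W_k` is no larger with
`Y_l` than with `Y_k`. So a random hash of slightly more than `H(W_k | W_1, …, W_{k-1}, Y_k)` bits
per symbol lets every terminal `l ≥ k` recover `W_k` once it knows `W_1, …, W_{k-1}`. The hash of
`W_k` may travel over any of the channels up to `k`, and the conditions on the partial sums are
exactly what makes room for all the hashes.
-/

namespace SuccRef

section Mean

variable {Z σ : Type*} [Fintype Z] {p f g : Z → ℝ} {E F : Set Z}

/-- The expectation of `f` under the weights `p`, which are not required to sum to one. -/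
def mean (p f : Z → ℝ) : ℝ :=
  ∑ z, p z * f z

/-- The probability of the event `E` under the weights `p`. -/
noncomputable def mass (p : Z → ℝ) (E : Set Z) : ℝ :=
  mean p (E.indicator 1)

theorem mean_congr (h : ∀ z, p z ≠ 0 → f z = g z) : mean p f = mean p g :=
  Finset.sum_congr rfl fun z _ => by
    by_cases hz : p z = 0
    · simp [hz]
    · rw [h z hz]

theorem mean_mono (hp : 0 ≤ p) (h : ∀ z, 0 < p z → f z ≤ g z) : mean p f ≤ mean p g :=
  Finset.sum_le_sum fun z _ => by
    rcases (hp z).eq_or_lt with hz | hz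
    · simp [← hz]
    · exact mul_le_mul_of_nonneg_left (h z hz) hz.le

theorem mean_nonneg (hp : 0 ≤ p) (h : ∀ z, 0 < p z → 0 ≤ f z) : 0 ≤ mean p f :=
  Finset.sum_nonneg fun z _ => by
    rcases (hp z).eq_or_lt with hz | hz
    · simp [← hz]
    · exact mul_nonneg hz.le (h z hz)

theorem mean_add (p f g : Z → ℝ) : mean p (fun z => f z + g z) = mean p f + mean p g := by
  simp only [mean, mul_add, Finset.sum_add_distrib]

theorem mean_sub (p f g : Z → ℝ) : mean p (fun z => f z - g z) = mean p f - mean p g := by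
  simp only [mean, mul_sub, Finset.sum_sub_distrib]

theorem mean_const_mul (p : Z → ℝ) (c : ℝ) (f : Z → ℝ) :
    mean p (fun z => c * f z) = c * mean p f := by
  simp only [mean, Finset.mul_sum, mul_left_comm]

theorem mean_sum {ι : Type*} (s : Finset ι) (p : Z → ℝ) (f : ι → Z → ℝ) :
    mean p (fun z => ∑ i ∈ s, f i z) = ∑ i ∈ s, mean p (f i) := by
  simp only [mean, Finset.mul_sum]
  exact Finset.sum_comm

theorem mean_const (hp : p ∈ stdSimplex ℝ Z) (c : ℝ) : mean p (fun _ => c) = c := by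
  rw [mean, ← Finset.sum_mul, hp.2, one_mul]

theorem mass_nonneg (hp : 0 ≤ p) (E : Set Z) : 0 ≤ mass p E :=
  mean_nonneg hp fun _ _ => Set.indicator_nonneg (fun _ _ => zero_le_one) _

theorem mass_mono (hp : 0 ≤ p) (h : E ⊆ F) : mass p E ≤ mass p F :=
  mean_mono hp fun z _ => Set.indicator_le_indicator_of_subset h (fun _ => zero_le_one) z

theorem mass_pos (hp : 0 ≤ p) {z : Z} (hz : 0 < p z) (hE : z ∈ E) : 0 < mass p E :=
  Finset.sum_pos' (fun z _ => mul_nonneg (hp z) (Set.indicator_nonneg (fun _ _ => zero_le_one) z))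
    ⟨z, Finset.mem_univ z, by simpa [hE] using hz⟩

theorem mass_le_sum_mass {ι : Type*} [Fintype ι] (hp : 0 ≤ p) {G : ι → Set Z} (h : E ⊆ ⋃ i, G i) :
    mass p E ≤ ∑ i, mass p (G i) := by
  simp only [mass]
  rw [← mean_sum]
  refine mean_mono hp fun z _ => ?_
  have indicator_nonneg (i : ι) : 0 ≤ (G i).indicator (1 : Z → ℝ) z :=
    Set.indicator_nonneg (fun _ _ => zero_le_one) z
  refine Set.indicator_apply_le' (fun hz => ?_) fun _ => Finset.sum_nonneg fun i _ =>
    indicator_nonneg i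
  obtain ⟨i, hi⟩ := Set.mem_iUnion.1 (h hz)
  calc (1 : ℝ) = (G i).indicator 1 z := by rw [Set.indicator_of_mem hi, Pi.one_apply]
    _ ≤ _ := Finset.single_le_sum (f := fun i => (G i).indicator (1 : Z → ℝ) z)
        (fun i _ => indicator_nonneg i) (Finset.mem_univ i)

theorem sum_mass_mul [Fintype σ] (p : Z → ℝ) (S : Z → σ) (F : σ → ℝ) :
    ∑ s, mass p {z | S z = s} * F s = mean p (fun z => F (S z)) := by
  classical
  simp only [mass, mean, Finset.sum_mul]
  rw [Finset.sum_comm]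
  refine Finset.sum_congr rfl fun z _ => ?_
  simp [Set.indicator_apply]

theorem sum_mass_and (s : Finset σ) (p : Z → ℝ) (S : Z → σ) (E : Set Z) :
    ∑ a ∈ s, mass p {z | S z = a ∧ z ∈ E} = mass p {z | S z ∈ s ∧ z ∈ E} := by
  classical
  simp only [mass]
  rw [← mean_sum]
  congr 1 with z
  by_cases hz : z ∈ E <;> simp [Set.indicator_apply, hz]

theorem mean_logb_le_logb (hp : p ∈ stdSimplex ℝ Z) (hf : ∀ z, 0 < p z → 0 < f z) {c : ℝ}
    (hc : 0 < c) (hle : mean p f ≤ c) : mean p (fun z => Real.logb 2 (f z)) ≤ Real.logb 2 c := by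
  have log_two_pos : 0 < Real.log 2 := Real.log_pos one_lt_two
  have tangent (x : ℝ) (hx : 0 < x) :
      Real.logb 2 x ≤ (Real.logb 2 c - 1 / Real.log 2) + 1 / (c * Real.log 2) * x := by
    have h := Real.log_le_sub_one_of_pos (div_pos hx hc)
    rw [Real.log_div hx.ne' hc.ne'] at h
    simp only [Real.logb]
    field_simp
    field_simp at h
    linarith
  calc mean p (fun z => Real.logb 2 (f z))
      ≤ mean p (fun z => (Real.logb 2 c - 1 / Real.log 2) + 1 / (c * Real.log 2) * f z) :=
        mean_mono hp.1 fun z hz => tangent _ (hf z hz)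
    _ = (Real.logb 2 c - 1 / Real.log 2) + 1 / (c * Real.log 2) * mean p f := by
        rw [mean_add, mean_const hp, mean_const_mul]
    _ ≤ (Real.logb 2 c - 1 / Real.log 2) + 1 / (c * Real.log 2) * c := by gcongr
    _ = Real.logb 2 c := by
        field_simp
        ring

end Mean

section Iid

variable {Z : Type*} {p : Z → ℝ}

/-- The weights on sequences of length `n` whose letters are independent with weights `p`. -/
def iid (p : Z → ℝ) (n : ℕ) (z : Fin n → Z) : ℝ :=
  ∏ i, p (z i)

theorem iid_nonneg (hp : 0 ≤ p) (n : ℕ) : 0 ≤ iid p n :=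
  fun z => Finset.prod_nonneg fun i _ => hp (z i)

theorem pos_of_iid_pos (hp : 0 ≤ p) {n : ℕ} {z : Fin n → Z} (hz : 0 < iid p n z) (i : Fin n) :
    0 < p (z i) :=
  (hp (z i)).lt_of_ne' (Finset.prod_ne_zero_iff.1 hz.ne' i (Finset.mem_univ i))

variable [Fintype Z]

theorem mean_iid_prod (p : Z → ℝ) {n : ℕ} (f : Fin n → Z → ℝ) :
    mean (iid p n) (fun z => ∏ i, f i (z i)) = ∏ i, mean p (f i) := by
  simp only [mean, iid, ← Finset.prod_mul_distrib, Fintype.prod_sum]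

theorem iid_mem_stdSimplex (hp : p ∈ stdSimplex ℝ Z) (n : ℕ) :
    iid p n ∈ stdSimplex ℝ (Fin n → Z) := by
  refine ⟨iid_nonneg hp.1 n, ?_⟩
  simpa [mean, hp.2] using mean_iid_prod p (fun (_ : Fin n) (_ : Z) => (1 : ℝ))

theorem mass_iid (p : Z → ℝ) {n : ℕ} (E : Fin n → Set Z) :
    mass (iid p n) {z | ∀ i, z i ∈ E i} = ∏ i, mass p (E i) := by
  simp only [mass]
  rw [← mean_iid_prod]
  congr 1 with z
  simpa [Set.pi] using Set.indicator_pi_one_apply (M₀ := ℝ) Finset.univ E z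

theorem mean_iid_apply (hp : p ∈ stdSimplex ℝ Z) {n : ℕ} (i : Fin n) (f : Z → ℝ) :
    mean (iid p n) (fun z => f (z i)) = mean p f := by
  classical
  have h := mean_iid_prod p (fun j => if j = i then f else fun _ => 1)
  have hlhs (z : Fin n → Z) : ∏ j, (if j = i then f else fun _ => 1) (z j) = f (z i) := by
    rw [Fintype.prod_eq_single i fun j hj => by simp [hj], if_pos rfl]
  have hrhs : ∏ j, mean p (if j = i then f else fun _ => 1) = mean p f := by
    rw [Fintype.prod_eq_single i fun j hj => by simp [hj, mean_const hp], if_pos rfl]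
  simpa only [hlhs, hrhs] using h

theorem mean_iid_sum (hp : p ∈ stdSimplex ℝ Z) (n : ℕ) (f : Z → ℝ) :
    mean (iid p n) (fun z => ∑ i, f (z i)) = n * mean p f := by
  simp only [mean_sum, mean_iid_apply hp, Finset.sum_const, Finset.card_univ, Fintype.card_fin,
    nsmul_eq_mul]

end Iid

section Cond

variable {Z ν β : Type*} [Fintype Z] {p : Z → ℝ}

/-- The conditional probability of `V = v` given `B = b`, with value `0` where `B = b` has
probability zero. -/
noncomputable def condProb (p : Z → ℝ) (V : Z → ν) (B : Z → β) (v : ν) (b : β) : ℝ :=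
  mass p {z | V z = v ∧ B z = b} / mass p {z | B z = b}

theorem condProb_nonneg (hp : 0 ≤ p) (V : Z → ν) (B : Z → β) (v : ν) (b : β) :
    0 ≤ condProb p V B v b :=
  div_nonneg (mass_nonneg hp _) (mass_nonneg hp _)

theorem condProb_le_one (hp : 0 ≤ p) (V : Z → ν) (B : Z → β) (v : ν) (b : β) :
    condProb p V B v b ≤ 1 :=
  div_le_one_of_le₀ (mass_mono hp fun _ h => h.2) (mass_nonneg hp _)

theorem condProb_pos (hp : 0 ≤ p) (V : Z → ν) (B : Z → β) {z : Z} (hz : 0 < p z) :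
    0 < condProb p V B (V z) (B z) :=
  div_pos (mass_pos hp hz ⟨rfl, rfl⟩) (mass_pos hp hz rfl)

theorem sum_condProb_le_one [Fintype ν] (p : Z → ℝ) (V : Z → ν) (B : Z → β) (b : β) :
    ∑ v, condProb p V B v b ≤ 1 := by
  have marginal := sum_mass_and Finset.univ p V {z | B z = b}
  simp only [Set.mem_ofPred_eq, Finset.mem_univ, true_and] at marginal
  simp only [condProb]
  rw [← Finset.sum_div, marginal]
  exact div_self_le_one _

theorem condProb_iid (p : Z → ℝ) {n : ℕ} (V : Z → ν) (B : Z → β) (v : Fin n → ν)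
    (b : Fin n → β) :
    condProb (iid p n) (fun z i => V (z i)) (fun z i => B (z i)) v b =
      ∏ i, condProb p V B (v i) (b i) := by
  simp only [condProb, funext_iff, ← forall_and, Finset.prod_div_distrib]
  exact congrArg₂ _ (mass_iid p fun i => {z | V z = v i ∧ B z = b i})
    (mass_iid p fun i => {z | B z = b i})

/-- Reweighting by `Q / P(V | S)` replaces the conditional law of `V` by the kernel `Q`. -/
theorem mean_mul_div_condProb_le {σ : Type*} [Finite σ] [Fintype ν] (hp : 0 ≤ p)
    (V : Z → ν) (S : Z → σ) {φ : Z → ℝ} (hφ : 0 ≤ φ) (hφS : φ.FactorsThrough S)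
    {Q : ν → σ → ℝ} (hQ : ∀ v s, 0 ≤ Q v s) (hQsum : ∀ s, ∑ v, Q v s ≤ 1) :
    mean p (fun z => φ z * (Q (V z) (S z) / condProb p V S (V z) (S z))) ≤ mean p φ := by
  cases nonempty_fintype σ
  obtain ⟨ψ, hψ, rfl⟩ : ∃ ψ : σ → ℝ, 0 ≤ ψ ∧ φ = ψ ∘ S :=
    ⟨Function.extend S φ (0 : σ → ℝ), Function.extend_nonneg hφ le_rfl,
      funext fun z => (hφS.extend_apply 0 z).symm⟩
  have cancel (v : ν) (s : σ) :
      mass p {z | V z = v ∧ S z = s} * (ψ s * (Q v s / condProb p V S v s)) ≤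
        mass p {z | S z = s} * ψ s * Q v s := by
    have h0 : 0 ≤ mass p {z | S z = s} * ψ s * Q v s :=
      mul_nonneg (mul_nonneg (mass_nonneg hp _) (hψ s)) (hQ v s)
    rcases eq_or_ne (mass p {z | V z = v ∧ S z = s}) 0 with h | h
    · simpa [h] using h0
    · simp only [condProb]
      apply le_of_eq
      field_simp
  calc mean p (fun z => ψ (S z) * (Q (V z) (S z) / condProb p V S (V z) (S z)))
      = ∑ s, ∑ v, mass p {z | V z = v ∧ S z = s} * (ψ s * (Q v s / condProb p V S v s)) := by
        rw [← Fintype.sum_prod_type_right', ← sum_mass_mul p (fun z => (V z, S z))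
          (fun x => ψ x.2 * (Q x.1 x.2 / condProb p V S x.1 x.2))]
        simp only [Prod.ext_iff]
    _ ≤ ∑ s, mass p {z | S z = s} * ψ s * ∑ v, Q v s := by
        simp only [Finset.mul_sum]
        exact Finset.sum_le_sum fun s _ => Finset.sum_le_sum fun v _ => cancel v s
    _ ≤ ∑ s, mass p {z | S z = s} * ψ s :=
        Finset.sum_le_sum fun s _ => mul_le_of_le_one_right
          (mul_nonneg (mass_nonneg hp _) (hψ s)) (hQsum s)
    _ = mean p (ψ ∘ S) := sum_mass_mul p S ψ

end Cond

section Law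

variable {Z ν β : Type*}

/-- The weights of a probability mass function. -/
noncomputable def law (q : PMF Z) (z : Z) : ℝ :=
  (q z).toReal

theorem law_nonneg (q : PMF Z) : 0 ≤ law q :=
  fun _ => ENNReal.toReal_nonneg

theorem law_mem_stdSimplex [Fintype Z] (q : PMF Z) : law q ∈ stdSimplex ℝ Z := by
  refine ⟨law_nonneg q, ?_⟩
  simp only [law]
  rw [← ENNReal.toReal_sum fun z _ => q.apply_ne_top z, ← tsum_fintype (L := .unconditional Z),
    q.tsum_coe, ENNReal.toReal_one]

theorem prob_eq_mass [Fintype Z] (q : PMF Z) (V : Z → ν) (v : ν) :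
    prob q V v = mass (law q) {z | V z = v} := by
  classical
  rw [prob, PMF.map_apply, tsum_fintype, ENNReal.toReal_sum]
  · refine Finset.sum_congr rfl fun z _ => ?_
    by_cases h : V z = v
    · simp [h, law]
    · simp [h, Ne.symm h]
  · intro z _
    split_ifs
    · exact q.apply_ne_top z
    · simp

theorem condEntropy_eq_mean [Fintype Z] [Fintype ν] [Fintype β] (q : PMF Z) (V : Z → ν)
    (B : Z → β) :
    condEntropy q V B =
      mean (law q) (fun z => -Real.logb 2 (condProb (law q) V B (V z) (B z))) := by
  rw [← sum_mass_mul (law q) (fun z => (V z, B z))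
    (fun x => -Real.logb 2 (condProb (law q) V B x.1 x.2)), Fintype.sum_prod_type]
  simp only [condEntropy, prob_eq_mass, condProb, Prod.mk.injEq, mul_neg, Finset.sum_neg_distrib]

theorem condEntropy_nonneg [Finite Z] [Fintype ν] [Fintype β] (q : PMF Z) (V : Z → ν)
    (B : Z → β) :
    0 ≤ condEntropy q V B := by
  cases nonempty_fintype Z
  rw [condEntropy_eq_mean]
  exact mean_nonneg (law_nonneg q) fun z hz => neg_nonneg.2 <|
    Real.logb_nonpos one_lt_two (condProb_nonneg (law_nonneg q) V B _ _)
      (condProb_le_one (law_nonneg q) V B _ _)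

end Law

section Markov

variable {Z α β γ υ : Type*} {q : PMF Z} {A : Z → α} {B : Z → β} {C : Z → γ}
  {U : Z → υ}

theorem isMarkov_iff [Fintype Z] :
    IsMarkov q A B C ↔ ∀ a b c,
      mass (law q) {z | A z = a ∧ B z = b ∧ C z = c} * mass (law q) {z | B z = b} =
        mass (law q) {z | A z = a ∧ B z = b} * mass (law q) {z | B z = b ∧ C z = c} := by
  refine forall₃_congr fun a b c => ?_
  simp only [prob_eq_mass, Prod.mk.injEq]
  split_ifs with hb
  · rw [eq_div_iff hb.ne']
  · have hp := law_nonneg q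
    have hb0 : mass (law q) {z | B z = b} = 0 := le_antisymm (not_lt.1 hb) (mass_nonneg hp _)
    have hab0 : mass (law q) {z | A z = a ∧ B z = b} = 0 :=
      le_antisymm ((mass_mono hp fun _ h => h.2).trans_eq hb0) (mass_nonneg hp _)
    have habc0 : mass (law q) {z | A z = a ∧ B z = b ∧ C z = c} = 0 :=
      le_antisymm ((mass_mono hp fun _ h => h.2.1).trans_eq hb0) (mass_nonneg hp _)
    simp [hb0, hab0, habc0]

theorem IsMarkov.symm [Finite Z] (h : IsMarkov q A B C) : IsMarkov q C B A := by
  cases nonempty_fintype Z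
  refine isMarkov_iff.2 fun c b a => ?_
  have := isMarkov_iff.1 h a b c
  simp only [and_comm, and_assoc] at this ⊢
  rw [this, mul_comm]

theorem IsMarkov.comp_left [Finite Z] [Finite α] (h : IsMarkov q A B C) {α' : Type*} (f : α → α') :
    IsMarkov q (fun z => f (A z)) B C := by
  classical
  cases nonempty_fintype Z
  cases nonempty_fintype α
  refine isMarkov_iff.2 fun a' b c => ?_
  have fiber := sum_mass_and {a | f a = a'} (law q) A
  have hb := fiber {z | B z = b}
  have hbc := fiber {z | B z = b ∧ C z = c}
  simp only [Set.mem_ofPred_eq, Finset.mem_filter_univ] at hb hbc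
  rw [← hb, ← hbc, Finset.sum_mul, Finset.sum_mul]
  exact Finset.sum_congr rfl fun a _ => isMarkov_iff.1 h a b c

theorem IsMarkov.comp_right [Finite Z] [Finite γ] (h : IsMarkov q A B C) {γ' : Type*} (g : γ → γ') :
    IsMarkov q A B (fun z => g (C z)) :=
  (h.symm.comp_left g).symm

theorem IsMarkov.condProb_eq [Fintype Z] [Finite α] [Finite υ]
    (h : IsMarkov q (fun z => (A z, U z)) B C) {u : υ} {b : β} {c : γ}
    (h0 : mass (law q) {z | U z = u ∧ B z = b ∧ C z = c} ≠ 0) (a : α) :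
    condProb (law q) A (fun z => (U z, B z, C z)) a (u, b, c) =
      condProb (law q) A (fun z => (U z, B z)) a (u, b) := by
  have hp := law_nonneg q
  have hAU := isMarkov_iff.1 h (a, u) b c
  have hU : mass (law q) {z | U z = u ∧ B z = b ∧ C z = c} * mass (law q) {z | B z = b} =
      mass (law q) {z | U z = u ∧ B z = b} * mass (law q) {z | B z = b ∧ C z = c} :=
    isMarkov_iff.1 (h.comp_left Prod.snd) u b c
  have ne_zero_of_subset {E : Set Z} (hE : {z | U z = u ∧ B z = b ∧ C z = c} ⊆ E) :
      mass (law q) E ≠ 0 :=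
    (((mass_nonneg hp _).lt_of_ne' h0).trans_le (mass_mono hp hE)).ne'
  have hub : mass (law q) {z | U z = u ∧ B z = b} ≠ 0 :=
    ne_zero_of_subset fun z hz => ⟨hz.1, hz.2.1⟩
  have hb : mass (law q) {z | B z = b} ≠ 0 := ne_zero_of_subset fun z hz => hz.2.1
  simp only [condProb, Prod.mk.injEq, and_assoc] at hAU ⊢
  rw [div_eq_div_iff h0 hub]
  apply mul_right_cancel₀ hb
  linear_combination mass (law q) {z | U z = u ∧ B z = b} * hAU -
    mass (law q) {z | A z = a ∧ U z = u ∧ B z = b} * hU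

theorem IsMarkov.condEntropy_le [Finite Z] [Fintype α] [Fintype β] [Fintype γ] [Fintype υ]
    (h : IsMarkov q (fun z => (A z, U z)) B C) :
    condEntropy q A (fun z => (U z, B z)) ≤ condEntropy q A (fun z => (U z, C z)) := by
  cases nonempty_fintype Z
  have hp := law_nonneg q
  let coarse (z : Z) : ℝ := condProb (law q) A (fun z => (U z, C z)) (A z) (U z, C z)
  let fine (z : Z) : ℝ := condProb (law q) A (fun z => (U z, B z)) (A z) (U z, B z)
  have coarse_pos (z : Z) (hz : 0 < law q z) : 0 < coarse z :=
    condProb_pos hp A (fun z => (U z, C z)) hz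
  have fine_pos (z : Z) (hz : 0 < law q z) : 0 < fine z :=
    condProb_pos hp A (fun z => (U z, B z)) hz
  have ratio_pos (z : Z) (hz : 0 < law q z) : 0 < coarse z / fine z :=
    div_pos (coarse_pos z hz) (fine_pos z hz)
  have mean_ratio_le : mean (law q) (fun z => coarse z / fine z) ≤ 1 := by
    have key := mean_mul_div_condProb_le hp A (fun z => (U z, B z, C z)) (φ := 1) zero_le_one
      (fun _ _ _ => rfl) (Q := fun a s => condProb (law q) A (fun z => (U z, C z)) a (s.1, s.2.2))
      (fun _ _ => condProb_nonneg hp _ _ _ _) (fun _ => sum_condProb_le_one _ _ _ _)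
    refine (mean_mono hp fun z hz => ?_).trans (key.trans_eq (mean_const (law_mem_stdSimplex q) 1))
    have support_pos : 0 < mass (law q) {y | U y = U z ∧ B y = B z ∧ C y = C z} :=
      mass_pos hp hz ⟨rfl, rfl, rfl⟩
    rw [h.condProb_eq support_pos.ne', Pi.one_apply, one_mul]
  have mean_logb_ratio_nonpos : mean (law q) (fun z => Real.logb 2 (coarse z / fine z)) ≤ 0 :=
    (mean_logb_le_logb (law_mem_stdSimplex q) ratio_pos one_pos mean_ratio_le).trans_eq
      Real.logb_one
  rw [condEntropy_eq_mean, condEntropy_eq_mean, ← sub_nonpos, ← mean_sub]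
  refine (mean_congr fun z hz => ?_).trans_le mean_logb_ratio_nonpos
  have hz := (hp z).lt_of_ne' hz
  rw [Real.logb_div (coarse_pos z hz).ne' (fine_pos z hz).ne']
  ring

end Markov

section NoisyCopy

variable {α : Type*} [Fintype α] {δ : ℝ}

open scoped Classical in
/-- The weight of the letter `a` when the letter `b` is copied correctly with probability `1 - δ`
and the probability `δ` is spread uniformly; the diagonal omits its uniform share. -/
noncomputable def noisyCopy (δ : ℝ) (a b : α) : ℝ :=
  if a = b then 1 - δ else δ / Fintype.card α

theorem noisyCopy_pos (hδ : δ ∈ Set.Ioo 0 1) (a b : α) : 0 < noisyCopy δ a b := by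
  have : 0 < Fintype.card α := Fintype.card_pos_iff.2 ⟨a⟩
  unfold noisyCopy
  split_ifs
  · exact sub_pos.2 hδ.2
  · exact div_pos hδ.1 (Nat.cast_pos.2 this)

theorem sum_noisyCopy_le_one (hδ : δ ∈ Set.Ioo 0 1) (b : α) : ∑ a, noisyCopy δ a b ≤ 1 := by
  classical
  have card_pos : (0 : ℝ) < Fintype.card α := Nat.cast_pos.2 (Fintype.card_pos_iff.2 ⟨b⟩)
  calc ∑ a, noisyCopy δ a b
      ≤ ∑ a, ((if a = b then 1 - δ else 0) + δ / Fintype.card α) := by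
        refine Finset.sum_le_sum fun a _ => ?_
        have := div_pos hδ.1 card_pos
        unfold noisyCopy
        split_ifs <;> linarith
    _ = 1 := by
        rw [Finset.sum_add_distrib, Finset.sum_ite_eq', if_pos (Finset.mem_univ b),
          Finset.sum_const, Finset.card_univ, nsmul_eq_mul, mul_div_cancel₀ _ card_pos.ne',
          sub_add_cancel]

theorem sum_prod_noisyCopy_le_one (hδ : δ ∈ Set.Ioo 0 1) {n : ℕ} (b : Fin n → α) :
    ∑ a : Fin n → α, ∏ i, noisyCopy δ (a i) (b i) ≤ 1 := by
  classical
  rw [← Fintype.prod_sum fun i a => noisyCopy δ a (b i)]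
  exact Finset.prod_le_one (fun i _ => Finset.sum_nonneg fun a _ => (noisyCopy_pos hδ a _).le)
    fun i _ => sum_noisyCopy_le_one hδ _

open scoped Classical in
theorem le_logb_noisyCopy (hδ : δ ∈ Set.Ioo 0 1) (a b : α) :
    Real.logb 2 (1 - δ) - (if a = b then 0 else 1) * Real.logb 2 (Fintype.card α / δ) ≤
      Real.logb 2 (noisyCopy δ a b) := by
  unfold noisyCopy
  split_ifs
  · rw [zero_mul, sub_zero]
  · rw [one_mul, ← inv_div (Fintype.card α : ℝ) δ, Real.logb_inv]
    have := Real.logb_nonpos one_lt_two (sub_nonneg.2 hδ.2.le) (sub_le_self 1 hδ.1.le)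
    linarith

open scoped Classical in
theorem le_logb_prod_noisyCopy_div (hδ : δ ∈ Set.Ioo 0 1) {n : ℕ} (a b : Fin n → α)
    {P : Fin n → ℝ} (hP : ∀ i, 0 < P i) :
    n * Real.logb 2 (1 - δ) -
        (∑ i, if a i = b i then 0 else 1) * Real.logb 2 (Fintype.card α / δ) +
        ∑ i, -Real.logb 2 (P i) ≤
      Real.logb 2 ((∏ i, noisyCopy δ (a i) (b i)) / ∏ i, P i) := by
  rw [Real.logb_div (Finset.prod_pos fun i _ => noisyCopy_pos hδ _ _).ne'
      (Finset.prod_pos fun i _ => hP i).ne',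
    Real.logb_prod _ _ fun i _ => (noisyCopy_pos hδ _ _).ne',
    Real.logb_prod _ _ fun i _ => (hP i).ne', Finset.sum_neg_distrib, ← sub_eq_add_neg]
  gcongr
  calc _ = ∑ i, (Real.logb 2 (1 - δ) -
          (if a i = b i then 0 else 1) * Real.logb 2 (Fintype.card α / δ)) := by
        rw [Finset.sum_sub_distrib, Finset.sum_mul, Finset.sum_const, Finset.card_univ,
          Fintype.card_fin, nsmul_eq_mul]
    _ ≤ _ := Finset.sum_le_sum fun i _ => le_logb_noisyCopy hδ (a i) (b i)

end NoisyCopy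

section Source

variable {t : ℕ} {W Y : Fin t → Type*}

/-- A letter of the source together with the side information of all decoders. -/
abbrev Letter (W Y : Fin t → Type*) : Type _ :=
  (∀ l, W l) × ∀ l, Y l

/-- The information `(W_1, …, W_{k-1}, Y_l)` about the letter `W_k`. -/
def context (k l : Fin t) (z : Letter W Y) : (∀ j : {j : Fin t // j < k}, W j) × Y l :=
  (fun j => z.1 j, z.2 l)

/-- The information `(W_1, …, W_{k-1}, Y_k, Y_1, …, Y_{k-1})` about the letter `W_k`. -/
def history (k : Fin t) (z : Letter W Y) :
    (∀ j : {j : Fin t // j < k}, W j) × Y k × ∀ j : {j : Fin t // j < k}, Y j :=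
  (fun j => z.1 j, z.2 k, fun j => z.2 j)

/-- The part of the degradedness condition that involves the source: `X - Y_l - (Y_1, …, Y_{l-1})`
is a Markov chain for every `l`. -/
def IsSourceDegraded (q : PMF (Letter W Y)) : Prop :=
  ∀ l : Fin t, IsMarkov q (fun z => z.1) (fun z => z.2 l)
    (fun z => fun j : {j : Fin t // j < l} => z.2 j)

theorem IsDegraded.isSourceDegraded [∀ l, Finite (W l)] [∀ l, Finite (Y l)]
    {q : PMF (Letter W Y)} (hq : IsDegraded q) : IsSourceDegraded q :=
  fun l => (hq l).comp_left Prod.fst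

variable [∀ l, Fintype (W l)] [∀ l, Fintype (Y l)] {q : PMF (Letter W Y)}

/-- The entropy rate `H(W_k | W_1, …, W_{k-1}, Y_k)` of the `k`-th private message. -/
noncomputable def privateEntropy (q : PMF (Letter W Y)) (k : Fin t) : ℝ :=
  condEntropy q (fun z => z.1 k) (context k k)

/-- The conditional probability of the letter `w_k` given `w_1, …, w_{k-1}` and `y_k`. -/
noncomputable def letterProb (q : PMF (Letter W Y)) (k : Fin t) (z : Letter W Y) : ℝ :=
  condProb (law q) (fun z => z.1 k) (context k k) (z.1 k) (context k k z)

theorem letterProb_nonneg (q : PMF (Letter W Y)) (k : Fin t) (z : Letter W Y) :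
    0 ≤ letterProb q k z :=
  condProb_nonneg (law_nonneg q) _ _ _ _

theorem letterProb_pos (k : Fin t) {z : Letter W Y} (hz : 0 < law q z) : 0 < letterProb q k z :=
  condProb_pos (law_nonneg q) (fun z => z.1 k) (context k k) hz

theorem privateEntropy_eq_mean (q : PMF (Letter W Y)) (k : Fin t) :
    privateEntropy q k = mean (law q) (fun z => -Real.logb 2 (letterProb q k z)) :=
  condEntropy_eq_mean q _ _

theorem IsSourceDegraded.letterProb_eq (hq : IsSourceDegraded q) (k : Fin t) {z : Letter W Y}
    (hz : 0 < law q z) :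
    letterProb q k z =
      condProb (law q) (fun z => z.1 k) (history k) (z.1 k) (history k z) := by
  have chain := (hq k).comp_left fun w => (w k, fun j : {j : Fin t // j < k} => w j)
  have support_pos : 0 < mass (law q) {y | (fun j : {j : Fin t // j < k} => y.1 j) =
      (fun j : {j : Fin t // j < k} => z.1 j) ∧ y.2 k = z.2 k ∧
      (fun j : {j : Fin t // j < k} => y.2 j) = fun j : {j : Fin t // j < k} => z.2 j} :=
    mass_pos (law_nonneg q) hz ⟨rfl, rfl, rfl⟩
  exact (chain.condProb_eq support_pos.ne' (z.1 k)).symm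

end Source

section Converse

variable {t : ℕ} {W Y : Fin t → Type*} [∀ l, Fintype (W l)] [∀ l, Fintype (Y l)]
  {q : PMF (Letter W Y)} {n : ℕ}

theorem IsSourceDegraded.mean_likelihoodRatio_le_one (hq : IsSourceDegraded q)
    {Q : ∀ k, (Fin n → W k) → (Fin n → Y k) → ℝ} (hQ : ∀ k w y, 0 ≤ Q k w y)
    (hQsum : ∀ k y, ∑ w, Q k w y ≤ 1) (s : Finset (Fin t)) :
    mean (iid (law q) n) (fun z => ∏ k ∈ s, (Q k (fun i => (z i).1 k) (fun i => (z i).2 k) /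
      ∏ i, letterProb q k (z i))) ≤ 1 := by
  classical
  have hp := iid_nonneg (law_nonneg q) n
  induction s using Finset.induction_on_max with
  | empty => simpa using (mean_const (iid_mem_stdSimplex (law_mem_stdSimplex q) n) 1).le
  | insert l s hl ih =>
    refine le_trans ?_ ih
    have key := mean_mul_div_condProb_le hp (fun z i => (z i).1 l) (fun z i => history l (z i))
      (φ := fun z => ∏ k ∈ s, (Q k (fun i => (z i).1 k) (fun i => (z i).2 k) /
        ∏ i, letterProb q k (z i)))
      (fun z => Finset.prod_nonneg fun k _ => div_nonneg (hQ _ _ _)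
        (Finset.prod_nonneg fun i _ => letterProb_nonneg q k _))
      (fun z z' h => ?_)
      (Q := fun w b => Q l w fun i => (b i).2.1) (fun _ _ => hQ l _ _) (fun _ => hQsum l _)
    · refine (mean_congr fun z hz => ?_).trans_le key
      have hz := pos_of_iid_pos (law_nonneg q) ((hp z).lt_of_ne' hz)
      rw [Finset.prod_insert fun h => (hl l h).false, mul_comm,
        condProb_iid (law q) (fun z => z.1 l) (history l)]
      simp only [hq.letterProb_eq l (hz _)]
      rfl
    · simp only [funext_iff, history, Prod.ext_iff, Subtype.forall] at h
      refine Finset.prod_congr rfl fun k hk => ?_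
      have hW (i : Fin n) (j : Fin t) (hj : j < l) : (z i).1 j = (z' i).1 j := (h i).1 j hj
      have hY (i : Fin n) (j : Fin t) (hj : j < l) : (z i).2 j = (z' i).2 j := (h i).2.2 j hj
      have hcontext (i : Fin n) : context k k (z i) = context k k (z' i) :=
        Prod.ext (funext fun j => hW i j (j.2.trans (hl k hk))) (hY i k (hl k hk))
      simp only [letterProb, hcontext, hW _ k (hl k hk), hY _ k (hl k hk)]

theorem IsSourceDegraded.mean_likelihoodRatio_le_card {M : Type*} [Fintype M]
    (hq : IsSourceDegraded q) {Q : M → ∀ k, (Fin n → W k) → (Fin n → Y k) → ℝ}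
    (hQ : ∀ m k w y, 0 ≤ Q m k w y) (hQsum : ∀ m k y, ∑ w, Q m k w y ≤ 1) (s : Finset (Fin t))
    (f : (Fin n → Letter W Y) → M) :
    mean (iid (law q) n) (fun z => ∏ k ∈ s, (Q (f z) k (fun i => (z i).1 k) (fun i => (z i).2 k) /
      ∏ i, letterProb q k (z i))) ≤ Fintype.card M := by
  let ratio (m : M) (z : Fin n → Letter W Y) : ℝ :=
    ∏ k ∈ s, (Q m k (fun i => (z i).1 k) (fun i => (z i).2 k) / ∏ i, letterProb q k (z i))
  have ratio_nonneg (m : M) (z : Fin n → Letter W Y) : 0 ≤ ratio m z :=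
    Finset.prod_nonneg fun k _ => div_nonneg (hQ _ _ _ _)
      (Finset.prod_nonneg fun i _ => letterProb_nonneg q k _)
  calc mean (iid (law q) n) (fun z => ratio (f z) z)
      ≤ mean (iid (law q) n) (fun z => ∑ m, ratio m z) :=
        mean_mono (iid_nonneg (law_nonneg q) n) fun z _ => Finset.single_le_sum
          (f := fun m => ratio m z) (fun m _ => ratio_nonneg m z) (Finset.mem_univ (f z))
    _ = ∑ m, mean (iid (law q) n) (ratio m) := mean_sum _ _ _
    _ ≤ ∑ _m : M, (1 : ℝ) :=
        Finset.sum_le_sum fun m _ => hq.mean_likelihoodRatio_le_one (hQ m) (hQsum m) s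
    _ = Fintype.card M := by rw [Finset.sum_const, Finset.card_univ, nsmul_eq_mul, mul_one]

theorem IsSourceDegraded.mean_noisyCopy_ratio_le (hq : IsSourceDegraded q)
    (c : Code (∀ l, W l) Y W n) {δ : ℝ} (hδ : δ ∈ Set.Ioo 0 1) (l : Fin t) :
    mean (iid (law q) n) (fun z => ∏ k ∈ Finset.Iic l,
        ((∏ i, noisyCopy δ ((z i).1 k) (c.replica k z i)) / ∏ i, letterProb q k (z i))) ≤
      ∏ k ∈ Finset.Iic l, (c.size k : ℝ) := by
  have bound := hq.mean_likelihoodRatio_le_card (M := ∀ k : {k : Fin t // k ≤ l}, Fin (c.size k))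
    (Q := fun m k w y => if hk : k ≤ l then
      ∏ i, noisyCopy δ (w i) (c.dec k (fun j => m ⟨j, j.2.trans hk⟩) y i) else 0)
    (fun _ _ _ _ => by
      split_ifs
      · exact Finset.prod_nonneg fun i _ => (noisyCopy_pos hδ _ _).le
      · exact le_rfl)
    (fun _ _ _ => by
      split_ifs
      · exact sum_prod_noisyCopy_le_one hδ _
      · simp)
    (Finset.Iic l) (fun z k => c.enc (fun i => (z i).1) k)
  have card_eq : (Fintype.card (∀ k : {k : Fin t // k ≤ l}, Fin (c.size k)) : ℝ) =
      ∏ k ∈ Finset.Iic l, (c.size k : ℝ) := by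
    simp only [Fintype.card_pi, Fintype.card_fin, Nat.cast_prod]
    exact (Finset.prod_subtype (Finset.Iic l) (fun k => Finset.mem_Iic)
      (fun k => (c.size k : ℝ))).symm
  refine (mean_congr fun z _ => Finset.prod_congr rfl fun k hk => ?_).trans_le
    (bound.trans_eq card_eq)
  rw [dif_pos (Finset.mem_Iic.1 hk)]
  rfl

theorem mean_logb_noisyCopy_lower_bound_eq (hn : 0 < n) (c : Code (∀ l, W l) Y W n) (δ : ℝ)
    (k : Fin t) :
    mean (iid (law q) n) (fun z => n * Real.logb 2 (1 - δ) -
        (∑ i, (privateDistortion W k (z i).1 (c.replica k z i) : ℝ)) *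
          Real.logb 2 (Fintype.card (W k) / δ) + ∑ i, -Real.logb 2 (letterProb q k (z i))) =
      n * (Real.logb 2 (1 - δ) - c.distortion q (privateDistortion W) k *
        Real.logb 2 (Fintype.card (W k) / δ) + privateEntropy q k) := by
  have hp := law_mem_stdSimplex q
  have distortion_eq : mean (iid (law q) n) (fun z =>
      ∑ i, (privateDistortion W k (z i).1 (c.replica k z i) : ℝ)) =
        n * c.distortion q (privateDistortion W) k := by
    change _ = n * mean (iid (law q) n) (fun z => 1 / n *
      ∑ i, (privateDistortion W k (z i).1 (c.replica k z i) : ℝ))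
    rw [mean_const_mul, ← mul_assoc, mul_one_div_cancel (Nat.cast_ne_zero.2 hn.ne'), one_mul]
  simp only [mul_comm _ (Real.logb 2 (_ / δ))]
  rw [mean_add, mean_sub, mean_const (iid_mem_stdSimplex hp n), mean_const_mul, distortion_eq,
    mean_iid_sum hp n fun z => -Real.logb 2 (letterProb q k z), ← privateEntropy_eq_mean]
  ring

theorem IsSourceDegraded.sum_privateEntropy_le_sum_rate (hq : IsSourceDegraded q) (hn : 0 < n)
    (c : Code (∀ l, W l) Y W n) {δ : ℝ} (hδ : δ ∈ Set.Ioo 0 1) (l : Fin t) :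
    ∑ k ∈ Finset.Iic l, privateEntropy q k ≤
      ∑ k ∈ Finset.Iic l, (c.rate k - Real.logb 2 (1 - δ) +
        c.distortion q (privateDistortion W) k * Real.logb 2 (Fintype.card (W k) / δ)) := by
  classical
  have hp := law_nonneg q
  have size_pos (k : Fin t) : (0 : ℝ) < c.size k := by
    obtain ⟨z₀, -⟩ := q.support_nonempty
    exact Nat.cast_pos.2 (c.enc (fun _ => z₀.1) k).pos
  have ratio_pos (k : Fin t) (z : Fin n → Letter W Y) (hz : 0 < iid (law q) n z) :
      0 < (∏ i, noisyCopy δ ((z i).1 k) (c.replica k z i)) / ∏ i, letterProb q k (z i) :=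
    div_pos (Finset.prod_pos fun i _ => noisyCopy_pos hδ _ _)
      (Finset.prod_pos fun i _ => letterProb_pos k (pos_of_iid_pos hp hz i))
  have jensen : mean (iid (law q) n) (fun z => Real.logb 2 (∏ k ∈ Finset.Iic l,
      ((∏ i, noisyCopy δ ((z i).1 k) (c.replica k z i)) / ∏ i, letterProb q k (z i)))) ≤
        ∑ k ∈ Finset.Iic l, Real.logb 2 (c.size k) := by
    rw [← Real.logb_prod _ _ fun k _ => (size_pos k).ne']
    exact mean_logb_le_logb (iid_mem_stdSimplex (law_mem_stdSimplex q) n)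
      (fun z hz => Finset.prod_pos fun k _ => ratio_pos k z hz)
      (Finset.prod_pos fun k _ => size_pos k) (hq.mean_noisyCopy_ratio_le c hδ l)
  have total : ∑ k ∈ Finset.Iic l, n * (Real.logb 2 (1 - δ) -
      c.distortion q (privateDistortion W) k * Real.logb 2 (Fintype.card (W k) / δ) +
        privateEntropy q k) ≤ ∑ k ∈ Finset.Iic l, Real.logb 2 (c.size k) := by
    simp only [← mean_logb_noisyCopy_lower_bound_eq hn c δ]
    rw [← mean_sum]
    refine le_trans (mean_mono (iid_nonneg hp n) fun z hz => ?_) jensen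
    rw [Real.logb_prod _ _ fun k _ => (ratio_pos k z hz).ne']
    refine Finset.sum_le_sum fun k _ => ?_
    simpa [privateDistortion, apply_ite] using le_logb_prod_noisyCopy_div hδ (fun i => (z i).1 k)
      (c.replica k z) fun i => letterProb_pos k (pos_of_iid_pos hp hz i)
  have rate_eq (k : Fin t) : Real.logb 2 (c.size k) = n * c.rate k := by
    rw [Code.rate, ← mul_assoc, mul_one_div_cancel (Nat.cast_ne_zero.2 hn.ne'), one_mul]
  simp only [rate_eq, ← Finset.mul_sum] at total
  have := le_of_mul_le_mul_left total (Nat.cast_pos.2 hn)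
  simp only [Finset.sum_add_distrib, Finset.sum_sub_distrib] at this ⊢
  linarith

open Filter Topology in
theorem IsSourceDegraded.sum_privateEntropy_le (hq : IsSourceDegraded q) {r : Fin t → ℝ≥0}
    (hr : r ∈ rateRegion q (privateDistortion W) 0) (l : Fin t) :
    ∑ k ∈ Finset.Iic l, privateEntropy q k ≤ ∑ k ∈ Finset.Iic l, (r k : ℝ) := by
  have bound {δ : ℝ} (hδ : δ ∈ Set.Ioo 0 1) : ∑ k ∈ Finset.Iic l, privateEntropy q k ≤
      ∑ k ∈ Finset.Iic l, (r k + δ - Real.logb 2 (1 - δ) +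
        (δ * Real.log (Fintype.card (W k)) + Real.negMulLog δ) / Real.log 2) := by
    obtain ⟨n, hn, c, hdistortion, hrate⟩ := hr δ hδ.1
    refine (hq.sum_privateEntropy_le_sum_rate hn c hδ l).trans (Finset.sum_le_sum fun k _ => ?_)
    have one_le_card : (1 : ℝ) ≤ Fintype.card (W k) := by
      obtain ⟨z₀, -⟩ := q.support_nonempty
      exact Nat.one_le_cast.2 (Fintype.card_pos_iff.2 ⟨z₀.1 k⟩)
    have logb_nonneg : 0 ≤ Real.logb 2 (Fintype.card (W k) / δ) :=
      Real.logb_nonneg one_lt_two ((one_le_div hδ.1).2 (hδ.2.le.trans one_le_card))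
    have distortion_le : c.distortion q (privateDistortion W) k ≤ δ := by
      simpa using hdistortion k
    have penalty_eq : δ * Real.logb 2 (Fintype.card (W k) / δ) =
        (δ * Real.log (Fintype.card (W k)) + Real.negMulLog δ) / Real.log 2 := by
      rw [Real.logb, Real.log_div (zero_lt_one.trans_le one_le_card).ne' hδ.1.ne', Real.negMulLog]
      ring
    have := mul_le_mul_of_nonneg_right distortion_le logb_nonneg
    linarith [hrate k]
  have limit : Tendsto (fun δ : ℝ => ∑ k ∈ Finset.Iic l, (r k + δ - Real.logb 2 (1 - δ) +
      (δ * Real.log (Fintype.card (W k)) + Real.negMulLog δ) / Real.log 2)) (𝓝[>] 0)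
      (𝓝 (∑ k ∈ Finset.Iic l, (r k : ℝ))) := by
    have : ContinuousAt (fun δ : ℝ => ∑ k ∈ Finset.Iic l, (r k + δ - Real.logb 2 (1 - δ) +
        (δ * Real.log (Fintype.card (W k)) + Real.negMulLog δ) / Real.log 2)) 0 := by
      simp only [Real.logb]
      fun_prop (disch := norm_num)
    simpa using this.tendsto.mono_left nhdsWithin_le_nhds
  exact ge_of_tendsto limit <| by
    filter_upwards [Ioo_mem_nhdsGT one_pos] with δ hδ using bound hδ

end Converse

section Chernoff

open Filter Topology

variable {Z : Type*} [Fintype Z] {p f : Z → ℝ} {μ : ℝ}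

theorem exists_mean_exp_lt_one (hp : p ∈ stdSimplex ℝ Z) (hμ : mean p f < μ) :
    ∃ s, 0 < s ∧ mean p (fun z => Real.exp (s * (f z - μ))) < 1 := by
  have deriv_at_zero :
      HasDerivAt (fun s => mean p (fun z => Real.exp (s * (f z - μ))) - 1) (mean p f - μ) 0 := by
    have (z : Z) : HasDerivAt (fun s => p z * Real.exp (s * (f z - μ))) (p z * (f z - μ)) 0 := by
      simpa using ((hasDerivAt_mul_const (f z - μ)).exp.const_mul (p z) :
        HasDerivAt (fun s => p z * Real.exp (s * (f z - μ))) _ 0)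
    have slope_eq : ∑ z, p z * (f z - μ) = mean p f - μ := by
      rw [← mean_const hp μ, ← mean_sub, mean_const hp μ]
      rfl
    exact slope_eq ▸ (HasDerivAt.fun_sum fun z _ => this z).sub_const 1
  have sign_eq := eventually_nhdsWithin_sign_eq_of_deriv_neg
    (deriv_at_zero.deriv.trans_lt (sub_neg.2 hμ)) (by simp [mean_const hp])
  obtain ⟨s, hs, hs0⟩ := ((sign_eq.filter_mono nhdsWithin_le_nhds).and
    (self_mem_nhdsWithin : Set.Ioi (0 : ℝ) ∈ 𝓝[>] 0)).exists
  refine ⟨s, hs0, sub_neg.1 (sign_eq_neg_one_iff.1 (hs.trans (sign_neg (sub_neg.2 hs0))))⟩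

theorem mass_iid_sum_ge_le_pow (hp : 0 ≤ p) (f : Z → ℝ) (μ : ℝ) {s : ℝ} (hs : 0 ≤ s) (n : ℕ) :
    mass (iid p n) {z | n * μ ≤ ∑ i, f (z i)} ≤
      mean p (fun z => Real.exp (s * (f z - μ))) ^ n := by
  have exponential_markov :
      mass (iid p n) {z | n * μ ≤ ∑ i, f (z i)} ≤
        mean (iid p n) (fun z => ∏ i, Real.exp (s * (f (z i) - μ))) := by
    refine mean_mono (iid_nonneg hp n) fun z _ => ?_
    rw [← Real.exp_sum]
    refine Set.indicator_apply_le' (fun hz => Real.one_le_exp ?_) fun _ => (Real.exp_pos _).le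
    rw [← Finset.mul_sum, Finset.sum_sub_distrib]
    exact mul_nonneg hs (by simpa using hz)
  rwa [mean_iid_prod p fun _ z => Real.exp (s * (f z - μ)), Fin.prod_const] at exponential_markov

theorem tendsto_mass_iid_sum_ge (hp : p ∈ stdSimplex ℝ Z) (hμ : mean p f < μ) :
    Tendsto (fun n => mass (iid p n) {z | n * μ ≤ ∑ i, f (z i)}) atTop (𝓝 0) := by
  obtain ⟨s, hs, hlt⟩ := exists_mean_exp_lt_one hp hμ
  exact squeeze_zero (fun n => mass_nonneg (iid_nonneg hp.1 n) _)
    (mass_iid_sum_ge_le_pow hp.1 f μ hs.le)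
    (tendsto_pow_atTop_nhds_zero_of_lt_one (mean_nonneg hp.1 fun _ _ => (Real.exp_pos _).le) hlt)

end Chernoff

section Binning

open scoped BigOperators

variable {α β M : Type*}

theorem expect_collision [Fintype α] [DecidableEq α] [Fintype M] [DecidableEq M] [Nonempty M]
    {a a' : α} (h : a ≠ a') :
    𝔼 φ : α → M, (if φ a = φ a' then 1 else 0 : ℝ) = 1 / Fintype.card M := by
  calc 𝔼 φ : α → M, (if φ a = φ a' then 1 else 0 : ℝ)
      = 𝔼 x : M × ({j // j ≠ a} → M), (if x.1 = x.2 ⟨a', h.symm⟩ then 1 else 0 : ℝ) :=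
        Fintype.expect_equiv (Equiv.funSplitAt a M) _ _ fun _ => rfl
    _ = 𝔼 ψ : {j // j ≠ a} → M, 𝔼 m : M, (if m = ψ ⟨a', h.symm⟩ then 1 else 0 : ℝ) := by
        rw [← Finset.univ_product_univ, Finset.expect_product, Finset.expect_comm]
    _ = 1 / Fintype.card M := by
        simp only [Fintype.expect_eq_sum_div_card (ι := M), Finset.sum_ite_eq', Finset.mem_univ,
          if_true]
        exact Fintype.expect_const _

/-- The decoder that is told the bin `m` under the binning `φ` and the side information `b`: it
picks a letter in the bin that is compatible with `b` in the sense of `T`, if there is one. -/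
noncomputable def binDecoder [Nonempty α] (T : α → β → Prop) (φ : α → M) (m : M) (b : β) : α :=
  Classical.epsilon fun a => T a b ∧ φ a = m

theorem binDecoder_eq [Nonempty α] {T : α → β → Prop} {φ : α → M} {a : α} {b : β} (hT : T a b)
    (hφ : ∀ a', a' ≠ a → T a' b → φ a' ≠ φ a) : binDecoder T φ (φ a) b = a := by
  have spec : T (binDecoder T φ (φ a) b) b ∧ φ (binDecoder T φ (φ a) b) = φ a :=
    Classical.epsilon_spec (p := fun a' => T a' b ∧ φ a' = φ a) ⟨a, hT, rfl⟩
  by_contra hne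
  exact hφ _ hne spec.1 spec.2

open scoped Classical in
theorem binDecoder_ne_le [Nonempty α] [Fintype α] (T : α → β → Prop) (φ : α → M) (a : α) (b : β) :
    (if binDecoder T φ (φ a) b ≠ a then 1 else 0 : ℝ) ≤
      (if ¬T a b then 1 else 0) + ∑ a' with a' ≠ a ∧ T a' b, if φ a' = φ a then 1 else 0 := by
  have collisions_nonneg (a' : α) : (0 : ℝ) ≤ if φ a' = φ a then 1 else 0 := by
    split_ifs <;> norm_num
  by_cases hT : T a b
  · by_cases hφ : ∀ a', a' ≠ a → T a' b → φ a' ≠ φ a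
    · simpa only [binDecoder_eq hT hφ, hT, ne_eq, not_true, if_false, zero_add] using
        Finset.sum_nonneg fun a' _ => collisions_nonneg a'
    · push Not at hφ
      obtain ⟨a', hne, hT', heq⟩ := hφ
      have := Finset.single_le_sum (s := {a' | a' ≠ a ∧ T a' b}) (fun a' _ => collisions_nonneg a')
        ((Finset.mem_filter_univ a').2 ⟨hne, hT'⟩)
      rw [if_pos heq] at this
      rw [if_neg (not_not.2 hT), zero_add]
      split_ifs
      · exact this
      · exact zero_le_one.trans this
  · rw [if_pos hT]
    have := Finset.sum_nonneg fun a' (_ : a' ∈ ({a' | a' ≠ a ∧ T a' b} : Finset α)) =>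
      collisions_nonneg a'
    split_ifs <;> linarith

open scoped Classical in
theorem expect_binDecoder_ne_le [Nonempty α] [Fintype α] [Fintype M] [Nonempty M]
    (T : α → β → Prop) (a : α) (b : β) :
    𝔼 φ : α → M, (if binDecoder T φ (φ a) b ≠ a then 1 else 0 : ℝ) ≤
      (if ¬T a b then 1 else 0) + ({a' | T a' b} : Finset α).card / Fintype.card M := by
  calc 𝔼 φ : α → M, (if binDecoder T φ (φ a) b ≠ a then 1 else 0 : ℝ)
      ≤ 𝔼 φ : α → M, ((if ¬T a b then 1 else 0) +
          ∑ a' with a' ≠ a ∧ T a' b, if φ a' = φ a then 1 else 0) :=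
        Finset.expect_le_expect fun φ _ => binDecoder_ne_le T φ a b
    _ = (if ¬T a b then 1 else 0) +
          ∑ a' with a' ≠ a ∧ T a' b, 𝔼 φ : α → M, (if φ a' = φ a then 1 else 0 : ℝ) := by
        rw [Finset.expect_add_distrib, Fintype.expect_const, Finset.expect_sum_comm]
    _ = (if ¬T a b then 1 else 0) +
          ({a' | a' ≠ a ∧ T a' b} : Finset α).card / Fintype.card M := by
        rw [Finset.sum_congr rfl fun a' ha' =>
            expect_collision ((Finset.mem_filter_univ a').1 ha').1,
          Finset.sum_const, nsmul_eq_mul, mul_one_div]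
    _ ≤ _ := by
        gcongr with a'
        exact And.right

variable {Z : Type*} [Fintype Z] {p : Z → ℝ}

open scoped Classical in
theorem expect_mass_binDecoder_ne_le [Nonempty α] [Fintype α] [Fintype M] [Nonempty M]
    (hp : p ∈ stdSimplex ℝ Z) (A : Z → α) (B : Z → β) (T : α → β → Prop) {N : ℝ}
    (hN : ∀ b, (({a | T a b} : Finset α).card : ℝ) ≤ N) :
    𝔼 φ : α → M, mass p {z | binDecoder T φ (φ (A z)) (B z) ≠ A z} ≤
      mass p {z | ¬T (A z) (B z)} + N / Fintype.card M := by
  calc 𝔼 φ : α → M, mass p {z | binDecoder T φ (φ (A z)) (B z) ≠ A z}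
      = mean p (fun z => 𝔼 φ : α → M,
          (if binDecoder T φ (φ (A z)) (B z) ≠ A z then 1 else 0 : ℝ)) := by
        simp only [mass, mean, Finset.expect_sum_comm, Finset.mul_expect, Set.indicator_apply,
          Set.mem_ofPred_eq, Pi.one_apply]
    _ ≤ mean p (fun z => {z | ¬T (A z) (B z)}.indicator 1 z + N / Fintype.card M) := by
        refine mean_mono hp.1 fun z _ => (expect_binDecoder_ne_le T (A z) (B z)).trans ?_
        rw [Set.indicator_apply]
        exact add_le_add le_rfl (div_le_div_of_nonneg_right (hN _) (Nat.cast_nonneg _))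
    _ = mass p {z | ¬T (A z) (B z)} + N / Fintype.card M := by
        rw [mean_add, mean_const hp, mass]

open scoped Classical in
theorem exists_sum_mass_binDecoder_ne_le {ι : Type*} [Fintype ι] {β : ι → Type*} [Nonempty α]
    [Fintype α] [Fintype M] [Nonempty M] (hp : p ∈ stdSimplex ℝ Z) (A : Z → α) (B : ∀ l, Z → β l)
    (T : ∀ l, α → β l → Prop) {N : ι → ℝ}
    (hN : ∀ l b, (({a | T l a b} : Finset α).card : ℝ) ≤ N l) :
    ∃ φ : α → M, ∑ l, mass p {z | binDecoder (T l) φ (φ (A z)) (B l z) ≠ A z} ≤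
      ∑ l, (mass p {z | ¬T l (A z) (B l z)} + N l / Fintype.card M) := by
  have average : 𝔼 φ : α → M, ∑ l, mass p {z | binDecoder (T l) φ (φ (A z)) (B l z) ≠ A z} ≤
      ∑ l, (mass p {z | ¬T l (A z) (B l z)} + N l / Fintype.card M) := by
    rw [Finset.expect_sum_comm]
    exact Finset.sum_le_sum fun l _ => expect_mass_binDecoder_ne_le hp A (B l) (T l) (hN l)
  obtain ⟨φ, -, hφ⟩ := Finset.exists_le_of_expect_le Finset.univ_nonempty average
  exact ⟨φ, hφ⟩

end Binning

section Hash

open Filter Topology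

variable {Z α β : Type*} [Fintype Z]

/-- The sequence `a` is typical given the sequence `b` if its conditional probability under the
iid law exceeds `2 ^ (-n μ)`. -/
def IsTypical (q : PMF Z) (A : Z → α) (B : Z → β) (μ : ℝ) {n : ℕ} (a : Fin n → α) (b : Fin n → β) :
    Prop :=
  (2 : ℝ) ^ (-(n * μ)) < ∏ i, condProb (law q) A B (a i) (b i)

open scoped Classical in
theorem card_isTypical_le [Fintype α] (q : PMF Z) (A : Z → α) (B : Z → β) (μ : ℝ) {n : ℕ}
    (b : Fin n → β) :
    (({a | IsTypical q A B μ a b} : Finset (Fin n → α)).card : ℝ) ≤ 2 ^ (n * μ) := by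
  have hc (a : α) (i : Fin n) : 0 ≤ condProb (law q) A B a (b i) :=
    condProb_nonneg (law_nonneg q) A B a (b i)
  rw [← neg_neg (n * μ), Real.rpow_neg zero_le_two, ← one_div, le_div_iff₀ (by positivity)]
  calc _ = ∑ a : Fin n → α with IsTypical q A B μ a b, (2 : ℝ) ^ (-(n * μ)) := by
        rw [Finset.sum_const, nsmul_eq_mul]
    _ ≤ ∑ a : Fin n → α with IsTypical q A B μ a b, ∏ i, condProb (law q) A B (a i) (b i) :=
        Finset.sum_le_sum fun a ha => ((Finset.mem_filter_univ a).1 ha).le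
    _ ≤ ∑ a : Fin n → α, ∏ i, condProb (law q) A B (a i) (b i) :=
        Finset.sum_le_sum_of_subset_of_nonneg (Finset.filter_subset _ _)
          fun a _ _ => Finset.prod_nonneg fun i _ => hc _ _
    _ = ∏ i, ∑ a, condProb (law q) A B a (b i) :=
        (Fintype.prod_sum fun i a => condProb (law q) A B a (b i)).symm
    _ ≤ 1 := Finset.prod_le_one (fun i _ => Finset.sum_nonneg fun a _ => hc _ _)
        fun i _ => sum_condProb_le_one _ _ _ _

theorem tendsto_mass_not_isTypical [Fintype α] [Fintype β] {q : PMF Z} {A : Z → α} {B : Z → β}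
    {μ : ℝ} (hμ : condEntropy q A B < μ) :
    Tendsto (fun n => mass (iid (law q) n)
      {z | ¬IsTypical q A B μ (fun i => A (z i)) fun i => B (z i)}) atTop (𝓝 0) := by
  have hp := law_nonneg q
  rw [condEntropy_eq_mean] at hμ
  refine squeeze_zero (fun n => mass_nonneg (iid_nonneg hp n) _) (fun n => ?_)
    (tendsto_mass_iid_sum_ge (law_mem_stdSimplex q) hμ)
  refine mean_mono (iid_nonneg hp n) fun z hz => ?_
  have hpos (i : Fin n) : 0 < condProb (law q) A B (A (z i)) (B (z i)) :=
    condProb_pos hp A B (pos_of_iid_pos hp hz i)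
  refine Set.indicator_apply_le' (fun hz => (Set.indicator_of_mem ?_ _).ge)
    fun _ => Set.indicator_nonneg (fun _ _ => zero_le_one) _
  have logb_le := (Real.logb_le_logb one_lt_two (Finset.prod_pos fun i _ => hpos i)
    (by positivity)).2 (not_lt.1 hz)
  rw [Real.logb_prod _ _ fun i _ => (hpos i).ne', Real.logb_rpow two_pos (by norm_num)] at logb_le
  rw [Set.mem_ofPred_eq, Finset.sum_neg_distrib]
  exact le_neg_of_le_neg logb_le

theorem eventually_exists_hash {ι : Type*} [Finite ι] {β : ι → Type*} [Fintype α]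
    [∀ l, Fintype (β l)] {q : PMF Z} {A : Z → α} {B : ∀ l, Z → β l} {H ε : ℝ}
    (hH : ∀ l, condEntropy q A (B l) < H) (hε : 0 < ε) :
    ∀ᶠ n : ℕ in atTop, ∀ b : ℕ, n * H ≤ b →
      ∃ h : (Fin n → α) → Fin b → Fin 2, ∃ D : ∀ l, (Fin b → Fin 2) → (Fin n → β l) → Fin n → α,
        ∀ l, mass (iid (law q) n) {z | D l (h fun i => A (z i)) (fun i => B l (z i)) ≠
          fun i => A (z i)} ≤ ε := by
  cases nonempty_fintype ι
  choose μ hμ hμH using fun l => exists_between (hH l)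
  have : Nonempty α := q.support_nonempty.to_type.map fun z => A z
  have limit : Tendsto (fun n : ℕ => ∑ l, (mass (iid (law q) n)
      {z | ¬IsTypical q A (B l) (μ l) (fun i => A (z i)) fun i => B l (z i)} +
        ((2 : ℝ) ^ (μ l - H)) ^ n)) atTop (𝓝 (∑ l : ι, (0 + 0))) :=
    tendsto_finsetSum _ fun l _ => (tendsto_mass_not_isTypical (hμ l)).add
      (tendsto_pow_atTop_nhds_zero_of_lt_one (by positivity)
        (Real.rpow_lt_one_of_one_lt_of_neg one_lt_two (sub_neg.2 (hμH l))))
  filter_upwards [limit.eventually (eventually_le_nhds (by simpa using hε))] with n hn b hb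
  have hp := iid_mem_stdSimplex (law_mem_stdSimplex q) n
  obtain ⟨h, hsum⟩ := exists_sum_mass_binDecoder_ne_le (M := Fin b → Fin 2) hp
    (fun z i => A (z i)) (fun l z i => B l (z i)) (fun l => IsTypical q A (B l) (μ l))
    fun l => card_isTypical_le q A (B l) (μ l)
  have collision_le (l : ι) :
      (2 : ℝ) ^ (n * μ l) / Fintype.card (Fin b → Fin 2) ≤ ((2 : ℝ) ^ (μ l - H)) ^ n := by
    rw [Fintype.card_fun, Fintype.card_fin, Fintype.card_fin, Nat.cast_pow, Nat.cast_ofNat,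
      ← Real.rpow_natCast, ← Real.rpow_sub two_pos, ← Real.rpow_mul_natCast zero_le_two]
    exact Real.rpow_le_rpow_of_exponent_le one_le_two (by linarith)
  refine ⟨h, fun l => binDecoder (IsTypical q A (B l) (μ l)) h, fun l => ?_⟩
  exact (Finset.single_le_sum (f := fun l => mass (iid (law q) n)
    {z | binDecoder (IsTypical q A (B l) (μ l)) h (h fun i => A (z i)) (fun i => B l (z i)) ≠
      fun i => A (z i)}) (fun l _ => mass_nonneg hp.1 _) (Finset.mem_univ l)).trans <|
    hsum.trans <| (Finset.sum_le_sum fun l _ => add_le_add le_rfl (collision_le l)).trans hn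

end Hash

section Allocation

variable {t : ℕ} {b m : Fin t → ℕ}

theorem val_finSigmaFinEquiv (x : (k : Fin t) × Fin (b k)) :
    (finSigmaFinEquiv x : ℕ) = ∑ j ∈ Finset.Iio x.1, b j + x.2 := by
  rw [finSigmaFinEquiv_apply]
  congr 1
  refine Finset.sum_bij (fun i _ => Fin.castLE x.1.2.le i) ?_ ?_ ?_ ?_
  · intro i _
    simp [Fin.lt_def]
  · intro i _ j _ h
    simpa using h
  · intro j hj
    exact ⟨⟨j, Fin.lt_def.1 (Finset.mem_Iio.1 hj)⟩, Finset.mem_univ _, rfl⟩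
  · intro i _
    rfl

theorem exists_injective_sigma_fst_le
    (hbm : ∀ k, ∑ j ∈ Finset.Iic k, b j ≤ ∑ j ∈ Finset.Iic k, m j) :
    ∃ φ : ((k : Fin t) × Fin (b k)) → (k : Fin t) × Fin (m k),
      φ.Injective ∧ ∀ x, (φ x).1 ≤ x.1 := by
  have total_le : ∑ k, b k ≤ ∑ k, m k := by
    cases t with
    | zero => simp
    | succ t => simpa [← Fin.top_eq_last] using hbm (Fin.last t)
  -- Listing the slots of each family block by block, the `i`-th slot is sent to the `i`-th slot.
  refine ⟨fun x => finSigmaFinEquiv.symm (Fin.castLE total_le (finSigmaFinEquiv x)),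
    fun x y h => by simpa using h, fun x => ?_⟩
  set y := finSigmaFinEquiv.symm (Fin.castLE total_le (finSigmaFinEquiv x)) with hy
  have same_position : (finSigmaFinEquiv y : ℕ) = (finSigmaFinEquiv x : ℕ) := by simp [hy]
  rw [val_finSigmaFinEquiv, val_finSigmaFinEquiv] at same_position
  by_contra! hlt
  have hxy : ∑ j ∈ Finset.Iic x.1, m j ≤ ∑ j ∈ Finset.Iio y.1, m j :=
    Finset.sum_le_sum_of_subset fun j hj => Finset.mem_Iio.2 ((Finset.mem_Iic.1 hj).trans_lt hlt)
  have hb : ∑ j ∈ Finset.Iic x.1, b j = b x.1 + ∑ j ∈ Finset.Iio x.1, b j := by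
    rw [← Finset.Iio_insert, Finset.sum_insert Finset.notMem_Iio_self]
  have := hbm x.1
  have := x.2.isLt
  omega

end Allocation

section HashCode

variable {t n : ℕ} {W Y : Fin t → Type*} {b m : Fin t → ℕ}

/-- A decoder for the hash of the `k`-th private message at every terminal `l ≥ k`. It is told
the private messages of smaller index in addition to the side information. -/
abbrev HashDecoder (W Y : Fin t → Type*) (n : ℕ) (b : Fin t → ℕ) : Type _ :=
  ∀ k, ∀ l : {l : Fin t // k ≤ l}, (Fin (b k) → Fin 2) →
    (Fin n → (∀ j : {j : Fin t // j < k}, W j) × Y l) → Fin n → W k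

/-- The private messages `w_k` with `k ≤ l` are reproduced by the hash decoders of terminal `l`
from the hashes `u`, the side information `y` and the preceding private messages. -/
def IsConsistent (D : HashDecoder W Y n b) (l : Fin t) (u : ∀ k ≤ l, Fin (b k) → Fin 2)
    (y : Fin n → Y l) (w : Fin n → ∀ k, W k) : Prop :=
  ∀ k (hk : k ≤ l), D k ⟨l, hk⟩ (u k hk) (fun i => (fun j => w i j, y i)) = fun i => w i k

theorem IsConsistent.eq {D : HashDecoder W Y n b} {l : Fin t} {u : ∀ k ≤ l, Fin (b k) → Fin 2}
    {y : Fin n → Y l} {w w' : Fin n → ∀ k, W k} (hw : IsConsistent D l u y w)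
    (hw' : IsConsistent D l u y w') (k : Fin t) (hk : k ≤ l) (i : Fin n) : w i k = w' i k := by
  induction k using WellFoundedLT.induction generalizing i with
  | ind k ih =>
    have preceding_eq : (fun i => ((fun j : {j : Fin t // j < k} => w i j), y i)) =
        fun i => ((fun j : {j : Fin t // j < k} => w' i j), y i) :=
      funext fun i => Prod.ext (funext fun j => ih j j.2 (j.2.le.trans hk) i) rfl
    have := hw k hk
    rw [preceding_eq, hw' k hk] at this
    exact (congrFun this i).symm

/-- The code that sends the `b k` hash bits of each private message `w_k` over the channels up to
`k`, where `φ` says which of the `m l` bits of channel `l` carries which hash bit. Decoder `l`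
searches for private messages that are consistent with the hashes up to `l`. -/
noncomputable def hashCode [∀ k, Nonempty (W k)] (h : ∀ k, (Fin n → W k) → Fin (b k) → Fin 2)
    (D : HashDecoder W Y n b) (φ : ((k : Fin t) × Fin (b k)) → (k : Fin t) × Fin (m k))
    (hφ : ∀ x, (φ x).1 ≤ x.1) : Code (∀ l, W l) Y W n where
  size l := 2 ^ m l
  enc x l := finFunctionFinEquiv fun s =>
    Function.extend φ (fun a => h a.1 (fun i => x i a.1) a.2) 0 ⟨l, s⟩
  dec l msg y i := Classical.epsilon (IsConsistent D l (fun k hk s => finFunctionFinEquiv.symm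
    (msg ⟨(φ ⟨k, s⟩).1, (hφ ⟨k, s⟩).trans hk⟩) (φ ⟨k, s⟩).2) y) i l

theorem hashCode_replica [∀ k, Nonempty (W k)] {h : ∀ k, (Fin n → W k) → Fin (b k) → Fin 2}
    {D : HashDecoder W Y n b} {φ : ((k : Fin t) × Fin (b k)) → (k : Fin t) × Fin (m k)}
    (hinj : φ.Injective) (hφ : ∀ x, (φ x).1 ≤ x.1) {l : Fin t} {z : Fin n → Letter W Y}
    (hz : IsConsistent D l (fun k _ => h k fun i => (z i).1 k) (fun i => (z i).2 l)
      fun i => (z i).1) :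
    (hashCode h D φ hφ).replica l z = fun i => (z i).1 l := by
  have received_eq : (fun k (_ : k ≤ l) s => finFunctionFinEquiv.symm
      ((hashCode h D φ hφ).enc (fun i => (z i).1) (φ ⟨k, s⟩).1) (φ ⟨k, s⟩).2) =
      fun k _ => h k fun i => (z i).1 k := by
    funext k _ s
    simp only [hashCode, Equiv.symm_apply_apply]
    exact hinj.extend_apply (fun a => h a.1 (fun i => (z i).1 a.1) a.2) 0 ⟨k, s⟩
  rw [← received_eq] at hz
  exact funext ((Classical.epsilon_spec ⟨_, hz⟩).eq hz l le_rfl)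

end HashCode

section Achievability

open Filter Topology

theorem eventually_sum_ceil_le_sum_floor {ι : Type*} {s : Finset ι} {H r : ι → ℝ}
    (hH : ∀ k ∈ s, 0 ≤ H k) (hHr : ∑ k ∈ s, H k ≤ ∑ k ∈ s, r k) {ε : ℝ} (hε : 0 < ε) :
    ∀ᶠ n : ℕ in atTop, ∑ k ∈ s, ⌈n * (H k + ε / 2)⌉₊ ≤ ∑ k ∈ s, ⌊n * (r k + ε)⌋₊ := by
  filter_upwards [tendsto_natCast_atTop_atTop.eventually_ge_atTop (4 / ε)] with n hn
  rw [div_le_iff₀ hε] at hn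
  have hceil (k : ι) (hk : k ∈ s) : (⌈n * (H k + ε / 2)⌉₊ : ℝ) ≤ n * H k + (n * ε - 1) := by
    have := Nat.ceil_lt_add_one (a := n * (H k + ε / 2)) (by have := hH k hk; positivity)
    linarith
  have hfloor (k : ι) : n * r k + (n * ε - 1) ≤ ⌊n * (r k + ε)⌋₊ := by
    have := Nat.lt_floor_add_one (n * (r k + ε))
    linarith
  have : ∑ k ∈ s, (⌈n * (H k + ε / 2)⌉₊ : ℝ) ≤ ∑ k ∈ s, (⌊n * (r k + ε)⌋₊ : ℝ) := by
    calc ∑ k ∈ s, (⌈n * (H k + ε / 2)⌉₊ : ℝ)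
        ≤ ∑ k ∈ s, (n * H k + (n * ε - 1)) := Finset.sum_le_sum hceil
      _ = n * ∑ k ∈ s, H k + ∑ _k ∈ s, (n * ε - 1) := by
          rw [Finset.sum_add_distrib, Finset.mul_sum]
      _ ≤ n * ∑ k ∈ s, r k + ∑ _k ∈ s, (n * ε - 1) := by gcongr
      _ = ∑ k ∈ s, (n * r k + (n * ε - 1)) := by rw [Finset.sum_add_distrib, Finset.mul_sum]
      _ ≤ ∑ k ∈ s, (⌊n * (r k + ε)⌋₊ : ℝ) := Finset.sum_le_sum fun k _ => hfloor k
  exact_mod_cast this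

variable {t : ℕ} {W Y : Fin t → Type*} [∀ l, Fintype (W l)] [∀ l, Fintype (Y l)]
  {q : PMF (Letter W Y)}

theorem IsSourceDegraded.condEntropy_context_le (hq : IsSourceDegraded q) {k l : Fin t}
    (hkl : k ≤ l) : condEntropy q (fun z => z.1 k) (context k l) ≤ privateEntropy q k := by
  rcases hkl.eq_or_lt with rfl | hlt
  · exact le_rfl
  · have chain := ((hq l).comp_left fun w => (w k, fun j : {j : Fin t // j < k} => w j)).comp_right
      fun y => y ⟨k, hlt⟩
    exact chain.condEntropy_le

theorem distortion_le_mass_replica_ne {n : ℕ} (c : Code (∀ l, W l) Y W n) (l : Fin t) :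
    c.distortion q (privateDistortion W) l ≤
      mass (iid (law q) n) {z | c.replica l z ≠ fun i => (z i).1 l} := by
  refine mean_mono (iid_nonneg (law_nonneg q) n) fun z _ => ?_
  by_cases hz : c.replica l z = fun i => (z i).1 l
  · simp [hz, privateDistortion]
  · have : ∑ i, (privateDistortion W l (z i).1 (c.replica l z i) : ℝ) ≤ n := by
      refine (Finset.sum_le_card_nsmul _ _ (1 : ℝ) fun i _ => ?_).trans (by simp)
      unfold privateDistortion
      split_ifs <;> simp
    rw [Set.indicator_of_mem hz, one_div, ← div_eq_inv_mul]
    exact div_le_one_of_le₀ this n.cast_nonneg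

theorem hashCode_distortion_le {n : ℕ} [∀ k, Nonempty (W k)] {b m : Fin t → ℕ}
    {h : ∀ k, (Fin n → W k) → Fin (b k) → Fin 2} {D : HashDecoder W Y n b} {ε : ℝ}
    (hD : ∀ k l, mass (iid (law q) n) {z | D k l (h k fun i => (z i).1 k)
      (fun i => context k l (z i)) ≠ fun i => (z i).1 k} ≤ ε)
    {φ : ((k : Fin t) × Fin (b k)) → (k : Fin t) × Fin (m k)} (hinj : φ.Injective)
    (hφ : ∀ x, (φ x).1 ≤ x.1) (l : Fin t) :
    (hashCode h D φ hφ).distortion q (privateDistortion W) l ≤ (l + 1) * ε := by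
  have hp := iid_nonneg (law_nonneg q) n
  let error (k : Finset.Iic l) : Set (Fin n → Letter W Y) :=
    {z | D k ⟨l, Finset.mem_Iic.1 k.2⟩ (h k fun i => (z i).1 k) (fun i => context k l (z i)) ≠
      fun i => (z i).1 k}
  have error_subset : {z | (hashCode h D φ hφ).replica l z ≠ fun i => (z i).1 l} ⊆
      ⋃ k, error k := by
    intro z hz
    contrapose! hz
    simp only [error, Set.mem_iUnion, Set.mem_ofPred_eq, not_exists, not_not] at hz
    exact not_not.2 (hashCode_replica hinj hφ fun k hk => hz ⟨k, Finset.mem_Iic.2 hk⟩)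
  calc (hashCode h D φ hφ).distortion q (privateDistortion W) l
      ≤ mass (iid (law q) n) {z | (hashCode h D φ hφ).replica l z ≠ fun i => (z i).1 l} :=
        distortion_le_mass_replica_ne _ l
    _ ≤ ∑ k, mass (iid (law q) n) (error k) := mass_le_sum_mass hp error_subset
    _ ≤ ∑ _k : Finset.Iic l, ε := Finset.sum_le_sum fun k _ => hD k ⟨l, Finset.mem_Iic.1 k.2⟩
    _ = (l + 1) * ε := by simp

theorem IsSourceDegraded.mem_rateRegion (hq : IsSourceDegraded q) {r : Fin t → ℝ≥0}
    (hr : ∀ l, ∑ k ∈ Finset.Iic l, privateEntropy q k ≤ ∑ k ∈ Finset.Iic l, (r k : ℝ)) :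
    r ∈ rateRegion q (privateDistortion W) 0 := by
  intro ε hε
  obtain ⟨z₀, -⟩ := q.support_nonempty
  have (k : Fin t) : Nonempty (W k) := ⟨z₀.1 k⟩
  have ht : (0 : ℝ) < t + 1 := by positivity
  have hash := eventually_all.2 fun k => eventually_exists_hash (A := fun z => z.1 k)
    (B := fun l : {l : Fin t // k ≤ l} => context k l) (H := privateEntropy q k + ε / 2)
    (fun l => (hq.condEntropy_context_le l.2).trans_lt (lt_add_of_pos_right _ (half_pos hε)))
    (div_pos hε ht)
  have allocation := eventually_all.2 fun l => eventually_sum_ceil_le_sum_floor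
    (fun k _ => condEntropy_nonneg q (fun z => z.1 k) (context k k)) (hr l) hε
  obtain ⟨n, ⟨hhash, hallocation⟩, hn⟩ :=
    ((hash.and allocation).and (eventually_gt_atTop 0)).exists
  obtain ⟨φ, hinj, hφ⟩ := exists_injective_sigma_fst_le hallocation
  choose h D hD using fun k => hhash k _ (Nat.le_ceil _)
  refine ⟨n, hn, hashCode h D φ hφ, fun l => ?_, fun l => ?_⟩
  · have hl : ((l : ℕ) + 1 : ℝ) ≤ t + 1 := by exact_mod_cast Nat.succ_le_succ l.2.le
    refine (hashCode_distortion_le hD hinj hφ l).trans ?_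
    rw [Pi.zero_apply, NNReal.coe_zero, zero_add]
    exact (mul_le_mul_of_nonneg_right hl (div_pos hε ht).le).trans_eq (mul_div_cancel₀ ε ht.ne')
  · simp only [Code.rate, hashCode, Nat.cast_pow, Nat.cast_ofNat, Real.logb_pow,
      Real.logb_self_eq_one one_lt_two, mul_one, one_div]
    rw [inv_mul_le_iff₀ (Nat.cast_pos.2 hn)]
    exact Nat.floor_le (by positivity)

end Achievability

end SuccRef

theorem theorem3_general {t : ℕ} (W Y : Fin t → Type*) [∀ l, Fintype (W l)] [∀ l, Fintype (Y l)]
    (q : PMF ((∀ l, W l) × ∀ l, Y l)) (hq : SuccRef.IsSourceDegraded q) :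
    SuccRef.rateRegion q (SuccRef.privateDistortion W) 0 =
      {r : Fin t → ℝ≥0 | ∀ l : Fin t,
        ∑ k ∈ Finset.Iic l,
            SuccRef.condEntropy q (fun z => z.1 k)
              (fun z => ((fun j : {j : Fin t // j < k} => z.1 j), z.2 k))
          ≤ ∑ k ∈ Finset.Iic l, (r k : ℝ)} :=
  Set.ext fun _ => ⟨hq.sum_privateEntropy_le, hq.mem_rateRegion⟩

theorem theorem3 {t : ℕ} (W Y : Fin t → Type*) [∀ l, Fintype (W l)] [∀ l, Fintype (Y l)]
    (q : PMF ((∀ l, W l) × ∀ l, Y l)) (hq : SuccRef.IsDegraded q) :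
    SuccRef.rateRegion q (SuccRef.privateDistortion W) 0 =
      {r : Fin t → ℝ≥0 | ∀ l : Fin t,
        ∑ k ∈ Finset.Iic l,
            SuccRef.condEntropy q (fun z => z.1 k)
              (fun z => ((fun j : {j : Fin t // j < k} => z.1 j), z.2 k))
          ≤ ∑ k ∈ Finset.Iic l, (r k : ℝ)} :=
  theorem3_general W Y q hq.isSourceDegraded
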